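/- **Setting.** Fix integers $m,n$. The leader has actions $[m]=\{1,\dots,m\}$ and plays mixed strategies $x\in\Delta^m=\{x\in\mathbb R^m: x_i\ge 0,\ \sum_i x_i=1\}$; the follower has actions $[n]$. A *random Bayesian Stackelberg game* $\{R,\Theta,\{\mathcal C^\theta\}_{\theta\in\Theta},\mu,f\}$ consists of a finite set $\Theta$ of follower types, a leader utility matrix $R\in\mathbb R^{m\times n}$, a prior distribution $\mu$ on $\Theta$, and random follower utility matrices $\mathcal C^\theta\in\mathbb R^{m\times n}$, $\theta\in\Theta$, that are independent and identically distributed with law $f$. For $\theta\in\Theta$ and $j\in[n]$ let $$\mathrm{BR}_\theta(j)=\Big\{x\in\Delta^m:\ \sum_{i\in[m]}\mathcal C^\theta_{i,j}x_i\ \ge\ \sum_{i\in[m]}\mathcal C^\theta_{i,j'}x_i\ \text{ for all } j'\in[n]\Big\}$$ be the (random) set of leader strategies to which $j$ is a best response of type $\theta$. **Generic condition.** For each $j\in[n]$ there is a $j'\in[n]$ such that the law $\phi'$ on $\mathbb R^m$ of the column difference $\mathcal C^\theta_{\cdot,j}-\mathcal C^\theta_{\cdot,j'}$ induced by $f$ is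 even, i.e. $\phi'(X)=\phi'(-X)$ for every Borel set $X\subseteq\mathbb R^m$, and satisfies $\phi'(L)=0$ for every proper linear subspace $L\subsetneq\mathbb R^m$. **Theorem.** For all $m$ and $n$ there is a constant $K>0$, depending only on $m$ and $n$, such that every random Bayesian Stackelberg game with $m$ leader actions and $n$ follower actions that satisfies the generic condition, $|\Theta|-\big\lceil\log_{3/4}\tfrac1{|\Theta|}\big\rceil>0$ and $\tfrac{|\Theta|}2\ge m-2$ has $$P\Big(\bigcup_{i\in[n]}\ \bigcap_{\theta\in\Theta}\mathrm{BR}_\theta(i)\neq\emptyset\Big)\ \le\ \frac{K}{|\Theta|}.$$ -/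

import Mathlib

open MeasureTheory ProbabilityTheory

universe u v

/-- A (static) Bayesian Stackelberg game with leader actions `Fin m`, follower actions `Fin n` and
follower types `Θ`: the leader's utility matrix `R`, the follower's utility matrix `C θ` for every
type `θ`, and a prior distribution over the types. -/
structure BayesianStackelbergGame (m n : ℕ) (Θ : Type u) [Fintype Θ] where
  R : Matrix (Fin m) (Fin n) ℝ
  C : Θ → Matrix (Fin m) (Fin n) ℝ
  prior : Θ → ℝ
  prior_mem : prior ∈ stdSimplex ℝ Θ

namespace BayesianStackelbergGame

variable {m n : ℕ} {Θ : Type u} [Fintype Θ]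

/-- The expected utility `V^θ(x, j)` of a follower of type `θ` who answers `x` with `j`. -/
def followerUtility (G : BayesianStackelbergGame m n Θ) (θ : Θ) (x : Fin m → ℝ) (j : Fin n) : ℝ :=
  ∑ i, G.C θ i j * x i

/-- `BR(Θ', x)`: the follower actions that maximize the utility of some type in `Θ'`
when the leader plays `x`. -/
def bestResponses (G : BayesianStackelbergGame m n Θ) (Θ' : Set Θ) (x : Fin m → ℝ) :
    Set (Fin n) :=
  {j | ∃ θ ∈ Θ', ∀ j' : Fin n, G.followerUtility θ x j' ≤ G.followerUtility θ x j}

/-- `BR_θ(j)`: the mixed leader strategies to which `j` is a best response of type `θ`. -/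
def bestResponseRegion (G : BayesianStackelbergGame m n Θ) (θ : Θ) (j : Fin n) :
    Set (Fin m → ℝ) :=
  {x | x ∈ stdSimplex ℝ (Fin m) ∧ j ∈ G.bestResponses {θ} x}

end BayesianStackelbergGame

/-- Matrices carry the product (that is, the Borel) `σ`-algebra of their entries. -/
abbrev PayoffMatrix (m n : ℕ) : Type := Fin m → Fin n → ℝ

/-- A random Bayesian Stackelberg game, on a probability space `(Ω, P)`: the leader's utilities and
the prior are deterministic, while the follower's utility matrices are independent random matrices,
all with law `f`. -/
structure RandomBayesianStackelbergGame (m n : ℕ) (Θ : Type u) [Fintype Θ]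
    {Ω : Type v} [MeasurableSpace Ω] (P : Measure Ω) where
  R : Matrix (Fin m) (Fin n) ℝ
  prior : Θ → ℝ
  prior_mem : prior ∈ stdSimplex ℝ Θ
  f : Measure (PayoffMatrix m n)
  C : Θ → Ω → PayoffMatrix m n
  measurable_C : ∀ θ, Measurable (C θ)
  law_C : ∀ θ, P.map (C θ) = f
  indep_C : iIndepFun C P

namespace RandomBayesianStackelbergGame

variable {m n : ℕ} {Θ : Type u} [Fintype Θ] {Ω : Type v} [MeasurableSpace Ω] {P : Measure Ω}

/-- The Bayesian Stackelberg game realized at the outcome `ω`. -/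
def realization (G : RandomBayesianStackelbergGame m n Θ P) (ω : Ω) :
    BayesianStackelbergGame m n Θ where
  R := G.R
  C := fun θ => Matrix.of (G.C θ ω)
  prior := G.prior
  prior_mem := G.prior_mem

/-- The law, induced by `f`, of the difference of the columns `j` and `j'` of a follower's utility
matrix. -/
noncomputable def columnDifferenceLaw (G : RandomBayesianStackelbergGame m n Θ P) (j j' : Fin n) :
    Measure (Fin m → ℝ) :=
  G.f.map (fun A i => A i j - A i j')

/-- The generic condition for the follower's payoffs: every column `j` has a partner `j'` such that
the law of the difference of the two columns is even and gives no mass to any proper linear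
subspace of `ℝ^m`. -/
def GenericCondition (G : RandomBayesianStackelbergGame m n Θ P) : Prop :=
  ∀ j : Fin n, ∃ j' : Fin n,
    (∀ X : Set (Fin m → ℝ), MeasurableSet X →
      G.columnDifferenceLaw j j' X = G.columnDifferenceLaw j j' {x | -x ∈ X}) ∧
    (∀ L : Submodule ℝ (Fin m → ℝ), L ≠ ⊤ → G.columnDifferenceLaw j j' (L : Set (Fin m → ℝ)) = 0)

end RandomBayesianStackelbergGame

/-! ### Random vectors in general position -/

/-! Fix an action `j` and its partner `j'`, and put T = |Θ|. If one `x` makes `j` optimal for every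
type, then all T column differences lie in the closed half-space `0 ≤ d ⬝ᵥ x`. These differences are
iid with an even law, so each of the 2^T ways of negating some of them is equally likely to be
feasible (`two_pow_mul_measure_feasibleFamilies_le`). For a fixed family in general position, only
the weak sign patterns of nonzero vectors can be feasible. These have VC dimension at most m
(`vcDim_signPatterns_le`), so Sauer–Shelah leaves at most ∑_{k ≤ m} C(T, k) of them. The probability
for `j` is thus at most this polynomial over 2^T, which is O(1/T); a union bound over `j` finishes.
-/

theorem ae_linearIndependent_pi_fin {E : Type*} [NormedAddCommGroup E] [NormedSpace ℝ E]
    [FiniteDimensional ℝ E] [SecondCountableTopology E] [MeasurableSpace E] [BorelSpace E]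
    (μ : Measure E) [SigmaFinite μ]
    (hμ : ∀ L : Submodule ℝ E, L ≠ ⊤ → μ (L : Set E) = 0) (k : ℕ)
    (hk : k ≤ Module.finrank ℝ E) :
    ∀ᵐ u ∂Measure.pi (fun _ : Fin k => μ), LinearIndependent ℝ u := by
  induction k with
  | zero => exact Filter.Eventually.of_forall fun u => linearIndependent_empty_type
  | succ k ih =>
    have hmeas : ∀ l : ℕ, MeasurableSet {u : Fin l → E | LinearIndependent ℝ u} := fun l =>
      isOpen_setOfPred_linearIndependent.measurableSet
    have hcons : Measurable fun p : E × (Fin k → E) => (Fin.cons p.1 p.2 : Fin (k + 1) → E) := by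
      refine measurable_pi_lambda _ fun i => ?_
      refine Fin.cases ?_ (fun j => ?_) i
      · simpa using measurable_fst
      · simpa [Function.comp_def] using
          (measurable_pi_apply j).comp (measurable_snd (α := E) (β := Fin k → E))
    have hmp := measurePreserving_piFinSuccAbove (fun _ : Fin (k + 1) => μ) 0
    have key : ∀ᵐ p ∂(Measure.pi fun _ : Fin k => μ).prod μ,
        LinearIndependent ℝ (Fin.cons p.2 p.1 : Fin (k + 1) → E) := by
      have hset : MeasurableSet {p : (Fin k → E) × E |
          LinearIndependent ℝ (Fin.cons p.2 p.1 : Fin (k + 1) → E)} :=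
        (hcons.comp measurable_swap) (hmeas _)
      refine (Measure.ae_prod_iff_ae_ae hset).2 ?_
      filter_upwards [ih (by omega)] with u hu
      -- Fewer than dim E vectors span a proper subspace, which the next independent vector almost
      -- surely avoids.
      have hspan : Submodule.span ℝ (Set.range u) ≠ ⊤ := by
        intro h
        have h1 := finrank_range_le_card (R := ℝ) u
        rw [Set.finrank, h, finrank_top, Fintype.card_fin] at h1
        omega
      have h0 := hμ _ hspan
      rw [measure_eq_zero_iff_ae_notMem] at h0
      filter_upwards [h0] with v hv
      exact linearIndependent_finCons.2 ⟨hu, hv⟩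
    have key' : ∀ᵐ p ∂μ.prod (Measure.pi fun _ : Fin k => μ),
        LinearIndependent ℝ (Fin.cons p.1 p.2 : Fin (k + 1) → E) :=
      (Measure.measurePreserving_swap (μ := μ)
        (ν := Measure.pi fun _ : Fin k => μ)).quasiMeasurePreserving.ae key
    filter_upwards [hmp.quasiMeasurePreserving.ae key'] with u hu
    convert hu using 1
    ext i
    refine Fin.cases ?_ (fun j => ?_) i <;> simp [MeasurableEquiv.piFinSuccAbove,
      Fin.insertNthEquiv, Fin.tail]

theorem measurePreserving_pi_comp_injective {ι κ E : Type*} [Fintype ι] [Fintype κ]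
    [MeasurableSpace E] (μ : Measure E) [IsProbabilityMeasure μ] (e : κ → ι)
    (he : Function.Injective e) :
    MeasurePreserving (fun (d : ι → E) (i : κ) => d (e i)) (Measure.pi fun _ => μ)
      (Measure.pi fun _ => μ) := by
  have hmap : ∀ i : ι, (Measure.pi fun _ : ι => μ).map (fun d => d i) = μ := fun i =>
    (measurePreserving_eval (fun _ : ι => μ) i).map_eq
  have hind : iIndepFun (fun (i : ι) (d : ι → E) => d i) (Measure.pi fun _ => μ) := by
    rw [iIndepFun_iff_map_fun_eq_pi_map fun i => (measurable_pi_apply i).aemeasurable]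
    simp_rw [hmap]
    exact Measure.map_id
  refine ⟨measurable_pi_lambda _ fun i => measurable_pi_apply (e i), ?_⟩
  have h := (iIndepFun_iff_map_fun_eq_pi_map
    fun i => (measurable_pi_apply (e i)).aemeasurable).1 (hind.precomp he)
  refine h.trans ?_
  simp_rw [hmap]

theorem ae_linearIndependent_comp_injective {m : ℕ} {ι : Type*} [Fintype ι]
    (μ : Measure (Fin m → ℝ)) [IsProbabilityMeasure μ]
    (hμ : ∀ L : Submodule ℝ (Fin m → ℝ), L ≠ ⊤ → μ (L : Set (Fin m → ℝ)) = 0) :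
    ∀ᵐ d ∂Measure.pi (fun _ : ι => μ),
      ∀ e : Fin m → ι, Function.Injective e → LinearIndependent ℝ (d ∘ e) := by
  rw [ae_all_iff]
  intro e
  by_cases he : Function.Injective e
  · filter_upwards [(measurePreserving_pi_comp_injective μ e he).quasiMeasurePreserving.ae
      (ae_linearIndependent_pi_fin μ hμ m (by simp))] with d hd _
    exact hd
  · exact Filter.Eventually.of_forall fun d h => absurd h he

/-! ### Counting sign patterns -/

open Classical in
/-- The sets of indices on which a nonzero vector can be weakly on the positive side of all
the vectors `d i`, while being weakly on the negative side of the others. -/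
noncomputable def signPatterns {m : ℕ} {ι : Type*} [Fintype ι] (d : ι → Fin m → ℝ) :
    Finset (Finset ι) :=
  {s | ∃ x : Fin m → ℝ, x ≠ 0 ∧ ∀ i, if i ∈ s then 0 ≤ d i ⬝ᵥ x else d i ⬝ᵥ x ≤ 0}

theorem relation_ne_zero_of_general_position {m : ℕ} {v : Fin (m + 1) → Fin m → ℝ}
    (hv : ∀ i, LinearIndependent ℝ (fun j => v (Fin.succAbove i j))) {g : Fin (m + 1) → ℝ}
    (hg : ∑ i, g i • v i = 0) (hg0 : ∃ i, g i ≠ 0) (i : Fin (m + 1)) : g i ≠ 0 := by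
  intro hi
  obtain ⟨k, hk⟩ := hg0
  rw [Fin.sum_univ_succAbove _ i, hi, zero_smul, zero_add] at hg
  have h := Fintype.linearIndependent_iff.1 (hv i) (fun j => g (i.succAbove j)) hg
  obtain ⟨j, rfl⟩ := Fin.exists_succAbove_eq (x := k) (y := i) (by rintro rfl; exact hk hi)
  exact hk (h j)

theorem eq_zero_of_dotProduct_eq_zero {m : ℕ} {v : Fin m → Fin m → ℝ}
    (hv : LinearIndependent ℝ v) {x : Fin m → ℝ} (hx : ∀ i, v i ⬝ᵥ x = 0) : x = 0 := by
  have hspan := hv.span_eq_top_of_card_eq_finrank' (by simp)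
  have hall : ∀ w ∈ Submodule.span ℝ (Set.range v), w ⬝ᵥ x = 0 := by
    intro w hw
    induction hw using Submodule.span_induction with
    | mem w hw => obtain ⟨i, rfl⟩ := hw; exact hx i
    | zero => simp
    | add a b _ _ ha hb => rw [add_dotProduct, ha, hb, add_zero]
    | smul c a _ ha => rw [smul_dotProduct, ha, smul_zero]
  exact dotProduct_self_eq_zero.1 (hall x (hspan ▸ Submodule.mem_top))

open Classical in
-- Any m + 1 of the vectors satisfy a linear relation, and general position makes all its
-- coefficients nonzero. A nonzero `x` whose weak signs match those of the coefficients would be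
-- orthogonal to all of these vectors, which span. So no set of m + 1 indices is shattered.
theorem vcDim_signPatterns_le {m : ℕ} {ι : Type*} [Fintype ι] {d : ι → Fin m → ℝ}
    (hd : ∀ e : Fin m → ι, Function.Injective e → LinearIndependent ℝ (d ∘ e)) :
    (signPatterns d).vcDim ≤ m := by
  refine Finset.sup_le fun S hS => ?_
  rw [Finset.mem_shatterer] at hS
  by_contra! hcard
  obtain ⟨S', hS'S, hS'⟩ := Finset.exists_subset_card_eq hcard
  replace hS := hS.mono_right hS'S
  let e := S'.equivFinOfCardEq hS'
  let v : Fin (m + 1) → Fin m → ℝ := fun k => d (e.symm k)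
  have hinj : Function.Injective fun k => (e.symm k : ι) :=
    Subtype.val_injective.comp e.symm.injective
  have hv : ∀ i, LinearIndependent ℝ (fun j => v (Fin.succAbove i j)) := fun i =>
    hd _ (hinj.comp Fin.succAbove_right_injective)
  have hdep : ¬ LinearIndependent ℝ v := fun h => by
    have := h.fintype_card_le_finrank
    simp at this
  obtain ⟨g, hg, hg0⟩ := Fintype.not_linearIndependent_iff.1 hdep
  have hne := relation_ne_zero_of_general_position hv hg hg0
  -- The unrealizable pattern: the signs of the coefficients of the relation.
  obtain ⟨u, hu, hut⟩ := hS (t := (Finset.univ.filter fun k => 0 ≤ g k).image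
    fun k => (e.symm k : ι)) (by
      intro a ha
      obtain ⟨k, -, rfl⟩ := Finset.mem_image.1 ha
      exact (e.symm k).2)
  obtain ⟨x, hx0, hx⟩ := (Finset.mem_filter.1 hu).2
  have hmem : ∀ k, (e.symm k : ι) ∈ u ↔ 0 ≤ g k := by
    intro k
    have h1 : (e.symm k : ι) ∈ u ↔ (e.symm k : ι) ∈ S' ∩ u := by simp
    rw [h1, hut, Finset.mem_image]
    constructor
    · rintro ⟨l, hl, hlk⟩
      rw [← hinj hlk]
      exact (Finset.mem_filter.1 hl).2
    · exact fun h => ⟨k, by simpa using h, rfl⟩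
  have hnonneg : ∀ k, 0 ≤ g k * (v k ⬝ᵥ x) := by
    intro k
    have hk := hx (e.symm k)
    by_cases h : 0 ≤ g k
    · rw [if_pos ((hmem k).2 h)] at hk
      exact mul_nonneg h hk
    · rw [if_neg (mt (hmem k).1 h)] at hk
      exact mul_nonneg_of_nonpos_of_nonpos (not_le.1 h).le hk
  have hsum : ∑ k, g k * (v k ⬝ᵥ x) = 0 := by
    have := congrArg (· ⬝ᵥ x) hg
    simpa [sum_dotProduct, smul_dotProduct] using this
  have hzero : ∀ k, v k ⬝ᵥ x = 0 := fun k =>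
    (mul_eq_zero.1 ((Finset.sum_eq_zero_iff_of_nonneg fun k _ => hnonneg k).1 hsum k
      (Finset.mem_univ k))).resolve_left (hne k)
  exact hx0 (eq_zero_of_dotProduct_eq_zero (hv 0) fun j => hzero _)

theorem card_signPatterns_le {m : ℕ} {ι : Type*} [Fintype ι] {d : ι → Fin m → ℝ}
    (hd : ∀ e : Fin m → ι, Function.Injective e → LinearIndependent ℝ (d ∘ e)) :
    (signPatterns d).card ≤ ∑ k ∈ Finset.Iic m, (Fintype.card ι).choose k := by
  classical
  calc (signPatterns d).card ≤ (signPatterns d).shatterer.card := Finset.card_le_card_shatterer _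
    _ ≤ ∑ k ∈ Finset.Iic (signPatterns d).vcDim, (Fintype.card ι).choose k :=
        Finset.card_shatterer_le_sum_vcDim
    _ ≤ _ := Finset.sum_le_sum_of_subset (Finset.Iic_subset_Iic.2 (vcDim_signPatterns_le hd))

/-! ### The probability that random half-spaces meet in the simplex -/

/-- The families of vectors whose closed half-spaces have a common point in the simplex. -/
def feasibleFamilies (m : ℕ) (ι : Type*) : Set (ι → Fin m → ℝ) :=
  {d | ∃ x ∈ stdSimplex ℝ (Fin m), ∀ i, 0 ≤ d i ⬝ᵥ x}

/-- Projection along the compact simplex is a closed map. Closedness supplies the measurability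
needed later. -/
theorem isClosed_feasibleFamilies (m : ℕ) (ι : Type*) : IsClosed (feasibleFamilies m ι) := by
  have : CompactSpace (stdSimplex ℝ (Fin m)) :=
    isCompact_iff_compactSpace.1 (isCompact_stdSimplex ℝ (Fin m))
  have hcl : IsClosed {p : (ι → Fin m → ℝ) × stdSimplex ℝ (Fin m) |
      ∀ i, 0 ≤ p.1 i ⬝ᵥ p.2.1} := by
    simp only [Set.ofPred_forall]
    refine isClosed_iInter fun i => isClosed_le continuous_const ?_
    refine continuous_finsetSum _ fun k _ => Continuous.mul (by fun_prop) ?_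
    exact (continuous_apply k).comp (continuous_subtype_val.comp continuous_snd)
  convert isClosedMap_fst_of_compactSpace _ hcl using 1
  ext d
  constructor
  · rintro ⟨x, hx, h⟩
    exact ⟨(d, ⟨x, hx⟩), h, rfl⟩
  · rintro ⟨⟨_, x⟩, h, rfl⟩
    exact ⟨x.1, x.2, h⟩

open Classical in
/-- Negate the members of a family outside `s`. -/
noncomputable def negOutside {m : ℕ} {ι : Type*} (s : Finset ι) (d : ι → Fin m → ℝ) :
    ι → Fin m → ℝ :=
  fun i => (if i ∈ s then id else Neg.neg) (d i)

theorem measurePreserving_negOutside {m : ℕ} {ι : Type*} [Fintype ι] (s : Finset ι)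
    (μ : Measure (Fin m → ℝ)) [SigmaFinite μ] (hμ : μ.map Neg.neg = μ) :
    MeasurePreserving (negOutside s) (Measure.pi fun _ : ι => μ) (Measure.pi fun _ => μ) := by
  classical
  refine measurePreserving_pi (fun _ => μ) (fun _ => μ) fun i => ?_
  split_ifs
  · exact MeasurePreserving.id μ
  · exact ⟨measurable_neg, hμ⟩

theorem mem_signPatterns_of_negOutside_mem {m : ℕ} {ι : Type*} [Fintype ι] {s : Finset ι}
    {d : ι → Fin m → ℝ} (h : negOutside s d ∈ feasibleFamilies m ι) : s ∈ signPatterns d := by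
  classical
  obtain ⟨x, hx, hdx⟩ := h
  refine Finset.mem_filter.2 ⟨Finset.mem_univ _, x, ?_, fun i => ?_⟩
  · rintro rfl
    simpa using hx.2
  · have := hdx i
    by_cases hi : i ∈ s <;> simpa [negOutside, hi] using this

theorem two_pow_mul_measure_feasibleFamilies_le {m : ℕ} {ι : Type*} [Fintype ι]
    (μ : Measure (Fin m → ℝ)) [IsProbabilityMeasure μ] (hneg : μ.map Neg.neg = μ)
    (hμ : ∀ L : Submodule ℝ (Fin m → ℝ), L ≠ ⊤ → μ (L : Set (Fin m → ℝ)) = 0) :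
    2 ^ Fintype.card ι * (Measure.pi fun _ : ι => μ) (feasibleFamilies m ι) ≤
      ((∑ k ∈ Finset.Iic m, (Fintype.card ι).choose k : ℕ) : ENNReal) := by
  classical
  set ν := Measure.pi fun _ : ι => μ
  have hA := (isClosed_feasibleFamilies m ι).measurableSet
  have hpre : ∀ s : Finset ι, MeasurableSet (negOutside s ⁻¹' feasibleFamilies m ι) := fun s =>
    (measurePreserving_negOutside s μ hneg).measurable hA
  -- Double counting: sum over sign changes, then bound pointwise the number of feasible ones.
  calc 2 ^ Fintype.card ι * ν (feasibleFamilies m ι)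
      = ∑ s : Finset ι, ν (negOutside s ⁻¹' feasibleFamilies m ι) := by
        rw [Finset.sum_congr rfl fun s _ =>
          (measurePreserving_negOutside s μ hneg).measure_preimage hA.nullMeasurableSet]
        simp [ν]
    _ = ∫⁻ d, ∑ s : Finset ι, (negOutside s ⁻¹' feasibleFamilies m ι).indicator 1 d ∂ν := by
        rw [lintegral_finsetSum _ fun s _ => measurable_one.indicator (hpre s)]
        exact Finset.sum_congr rfl fun s _ => (lintegral_indicator_one (hpre s)).symm
    _ ≤ ∫⁻ _, ((∑ k ∈ Finset.Iic m, (Fintype.card ι).choose k : ℕ) : ENNReal) ∂ν := by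
        refine lintegral_mono_ae ?_
        filter_upwards [ae_linearIndependent_comp_injective (ι := ι) μ hμ] with d hd
        refine le_trans ?_ (Nat.cast_le.2 (card_signPatterns_le hd))
        simp only [Set.indicator_apply, Pi.one_apply, Finset.sum_boole]
        exact Nat.cast_le.2 (Finset.card_le_card fun s hs =>
          mem_signPatterns_of_negOutside_mem (Finset.mem_filter.1 hs).2)
    _ = _ := by simp

theorem exists_sum_choose_div_two_pow_le (m : ℕ) :
    ∃ B : ℝ, 0 < B ∧ ∀ T : ℕ, 0 < T →
      ((∑ k ∈ Finset.Iic m, T.choose k : ℕ) : ℝ) / 2 ^ T ≤ B / T := by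
  have hb : ∀ k : ℕ, ∃ b : ℝ, ∀ T : ℕ, (T : ℝ) ^ (k + 1) * (1 / 2) ^ T ≤ b := fun k => by
    obtain ⟨b, hb⟩ := (tendsto_pow_const_mul_const_pow_of_abs_lt_one (k + 1)
      (r := (1 / 2 : ℝ)) (by norm_num [abs_lt])).bddAbove_range
    exact ⟨b, fun T => hb ⟨T, rfl⟩⟩
  choose b hb using hb
  -- At T = 1 the bounded sequence equals 1/2.
  have hpos : ∀ k, 0 < b k := fun k => lt_of_lt_of_le (by norm_num) (hb k 1)
  refine ⟨∑ k ∈ Finset.Iic m, b k,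
    Finset.sum_pos (fun k _ => hpos k) ⟨m, Finset.mem_Iic.2 le_rfl⟩, fun T hT => ?_⟩
  have hT' : (0 : ℝ) < T := Nat.cast_pos.2 hT
  rw [le_div_iff₀ hT', Nat.cast_sum, Finset.sum_div, Finset.sum_mul]
  refine Finset.sum_le_sum fun k _ => le_trans ?_ (hb k T)
  have hc : (T.choose k : ℝ) ≤ (T : ℝ) ^ k := by exact_mod_cast Nat.choose_le_pow T k
  calc (T.choose k : ℝ) / 2 ^ T * T = T.choose k * (T * (1 / 2) ^ T) := by
        rw [one_div, inv_pow]; ring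
    _ ≤ (T : ℝ) ^ k * (T * (1 / 2) ^ T) := by gcongr
    _ = _ := by ring

/-! ### Application to random games -/

namespace RandomBayesianStackelbergGame

variable {m n : ℕ} {Θ : Type u} [Fintype Θ] {Ω : Type v} [MeasurableSpace Ω] {P : Measure Ω}

/-- The family of differences of the columns `j` and `j'` of the followers' payoffs. -/
def columnDifferences (G : RandomBayesianStackelbergGame m n Θ P) (j j' : Fin n) (ω : Ω) :
    Θ → Fin m → ℝ :=
  fun θ i => G.C θ ω i j - G.C θ ω i j'

theorem measurable_columnDifference (j j' : Fin n) :
    Measurable fun (A : PayoffMatrix m n) (i : Fin m) => A i j - A i j' := by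
  fun_prop

theorem map_columnDifferences [IsProbabilityMeasure P]
    (G : RandomBayesianStackelbergGame m n Θ P) (j j' : Fin n) :
    P.map (G.columnDifferences j j') = Measure.pi fun _ => G.columnDifferenceLaw j j' := by
  have hmeas := measurable_columnDifference (m := m) j j'
  have hind := G.indep_C.comp (fun _ (A : PayoffMatrix m n) i => A i j - A i j') fun _ => hmeas
  have h := (iIndepFun_iff_map_fun_eq_pi_map
    fun θ => (hmeas.comp (G.measurable_C θ)).aemeasurable).1 hind
  refine h.trans ?_
  congr 1
  ext1 θ
  rw [← Measure.map_map hmeas (G.measurable_C θ), G.law_C θ, columnDifferenceLaw]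

theorem isProbabilityMeasure_columnDifferenceLaw [IsProbabilityMeasure P] [Nonempty Θ]
    (G : RandomBayesianStackelbergGame m n Θ P) (j j' : Fin n) :
    IsProbabilityMeasure (G.columnDifferenceLaw j j') := by
  have : IsProbabilityMeasure G.f := by
    rw [← G.law_C (Classical.arbitrary Θ)]
    exact Measure.isProbabilityMeasure_map (G.measurable_C _).aemeasurable
  exact Measure.isProbabilityMeasure_map (measurable_columnDifference j j').aemeasurable

theorem columnDifferences_mem_feasibleFamilies (G : RandomBayesianStackelbergGame m n Θ P)
    [Nonempty Θ] {j : Fin n} (j' : Fin n) {ω : Ω}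
    (h : (⋂ θ : Θ, (G.realization ω).bestResponseRegion θ j).Nonempty) :
    G.columnDifferences j j' ω ∈ feasibleFamilies m Θ := by
  obtain ⟨x, hx⟩ := h
  rw [Set.mem_iInter] at hx
  refine ⟨x, (hx (Classical.arbitrary Θ)).1, fun θ => ?_⟩
  obtain ⟨θ', hθ', hbr⟩ := (hx θ).2
  rw [Set.mem_singleton_iff] at hθ'
  subst hθ'
  have := hbr j'
  simp only [BayesianStackelbergGame.followerUtility, realization, Matrix.of_apply] at this
  simpa [columnDifferences, dotProduct, sub_mul] using this

theorem measure_iInter_bestResponseRegion_nonempty_le [IsProbabilityMeasure P] [Nonempty Θ]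
    (G : RandomBayesianStackelbergGame m n Θ P) (hG : G.GenericCondition) (j : Fin n) :
    P.real {ω | (⋂ θ : Θ, (G.realization ω).bestResponseRegion θ j).Nonempty} ≤
      ((∑ k ∈ Finset.Iic m, (Fintype.card Θ).choose k : ℕ) : ℝ) / 2 ^ Fintype.card Θ := by
  obtain ⟨j', heven, hnull⟩ := hG j
  have := G.isProbabilityMeasure_columnDifferenceLaw j j'
  have hneg : (G.columnDifferenceLaw j j').map Neg.neg = G.columnDifferenceLaw j j' := by
    ext X hX
    rw [Measure.map_apply measurable_neg hX, heven X hX]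
    rfl
  have hbound := two_pow_mul_measure_feasibleFamilies_le (ι := Θ) _ hneg hnull
  have hmeas : Measurable (G.columnDifferences j j') := measurable_pi_lambda _ fun θ =>
    (measurable_columnDifference j j').comp (G.measurable_C θ)
  rw [← G.map_columnDifferences, Measure.map_apply hmeas
    (isClosed_feasibleFamilies m Θ).measurableSet] at hbound
  rw [le_div_iff₀ (by positivity), mul_comm]
  have hreal := ENNReal.toReal_mono (ENNReal.natCast_ne_top _) hbound
  rw [ENNReal.toReal_mul, ENNReal.toReal_pow, ENNReal.toReal_ofNat, ENNReal.toReal_natCast]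
    at hreal
  refine le_trans ?_ hreal
  gcongr
  exact measureReal_mono fun ω hω => G.columnDifferences_mem_feasibleFamilies j' hω

end RandomBayesianStackelbergGame

theorem mainTheorem1 (m n : ℕ) :
    ∃ K : ℝ, 0 < K ∧
      ∀ (Θ : Type u) [Fintype Θ] (Ω : Type v) [MeasurableSpace Ω]
        (P : Measure Ω) [IsProbabilityMeasure P]
        (G : RandomBayesianStackelbergGame m n Θ P),
        G.GenericCondition →
        (Fintype.card Θ : ℤ) - ⌈Real.logb (3 / 4) (1 / (Fintype.card Θ : ℝ))⌉ > 0 →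
        (Fintype.card Θ : ℝ) / 2 ≥ (m : ℝ) - 2 →
        P.real {ω | (⋃ i : Fin n, ⋂ θ : Θ, (G.realization ω).bestResponseRegion θ i) ≠ ∅} ≤
          K / (Fintype.card Θ : ℝ) := by
  obtain ⟨B, hB, hbound⟩ := exists_sum_choose_div_two_pow_le m
  -- The factor `n + 1` in place of `n` keeps the constant positive when `n = 0`.
  refine ⟨(n + 1) * B, by positivity, ?_⟩
  intro Θ _ Ω _ P _ G hG hcard _
  -- For empty Θ the conventions `1 / 0 = 0` and `logb _ 0 = 0` turn `hcard` into `0 > 0`.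
  have hpos : 0 < Fintype.card Θ := by
    rw [Nat.pos_iff_ne_zero]
    intro h
    simp [h] at hcard
  have : Nonempty Θ := Fintype.card_pos_iff.1 hpos
  have hset : {ω | (⋃ i : Fin n, ⋂ θ : Θ, (G.realization ω).bestResponseRegion θ i) ≠ ∅} =
      ⋃ i : Fin n, {ω | (⋂ θ : Θ, (G.realization ω).bestResponseRegion θ i).Nonempty} := by
    ext ω
    simp only [Set.mem_ofPred_eq, Set.mem_iUnion, ← Set.nonempty_iff_ne_empty,
      Set.nonempty_iUnion]
  rw [hset]
  calc P.real (⋃ i : Fin n, {ω | (⋂ θ : Θ, (G.realization ω).bestResponseRegion θ i).Nonempty})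
      ≤ ∑ i : Fin n, P.real {ω | (⋂ θ : Θ, (G.realization ω).bestResponseRegion θ i).Nonempty} :=
        measureReal_iUnion_fintype_le _
    _ ≤ ∑ _i : Fin n, B / (Fintype.card Θ : ℝ) := Finset.sum_le_sum fun i _ =>
        (G.measure_iInter_bestResponseRegion_nonempty_le hG i).trans (hbound _ hpos)
    _ = n * B / (Fintype.card Θ : ℝ) := by simp [mul_div_assoc]
    _ ≤ (n + 1) * B / (Fintype.card Θ : ℝ) := by gcongr; linarith
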